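/- A \emph{generalised relation} on a set $X$ is a function $\mathbf d:X\times X\to[0,\infty]$, written $x\mathbf dy$; these are ordered pointwise. A classical relation $R$ is identified with its characteristic function (value $0$ where $R$ holds, $\infty$ elsewhere), and $x\leq^{\mathbf d}y$ means $x\mathbf dy=0$. The upper and lower hemimetrics of $\mathbf d$ are $$x\overline{\mathbf d}z=\sup_{y\in X}(x\mathbf dy-z\mathbf dy)_+,\qquad z\underline{\mathbf d}y=\sup_{x\in X}(x\mathbf dy-x\mathbf dz)_+\qquad(\text{with }\infty-\infty=0).$$ $\mathbf d$ is a \emph{distance} if $x\mathbf dy\leq x\mathbf dz+z\mathbf dy$ for all $x,y,z$, and a \emph{hemimetric} if moreover $x\mathbf dx=0$ for all $x$. The strict order $<^{\mathbf d}$ is defined by: $x<^{\mathbf d}y$ iff $\{z:x\leq^{\mathbf d}z\}$ is a neighbourhood of $y$ in the topology generated by the sets $\{z:c\,\underline{\mathbf d}\,z<r\}$ ($c\in X$, $r>0$). Nets are indexed by nonempty sets with a transitive (not necessarily reflexive) relation $\prec$ such that any two indices $\gamma,\delta$ have a $\lambda$ with $\gamma,\delta\prec\lambda$. A net $(x_\lambda)$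 is \emph{$\mathbf d$-Cauchy} if $\lim_\gamma\sup_{\gamma\prec\delta}x_\gamma\mathbf dx_\delta=0$. The \emph{Smyth topology} $\mathbf d^\bullet_\circ$ is generated by the sets $\{x:c\mathbf dx<r\}$ and $\{x:c\mathbf dx>r\}$. $X$ is \emph{$\mathbf d^\bullet_\circ$-complete} (Smyth complete) if every $\mathbf d$-Cauchy net has a $\mathbf d^\bullet_\circ$-limit, and \emph{$\mathbf d^\bullet_\circ$-continuous} if every point is a $\mathbf d^\bullet_\circ$-limit of a $\mathbf d$-Cauchy net. $X$ is a \emph{$\mathbf d^\bullet_\circ$-domain} if it is $\mathbf d^\bullet_\circ$-complete and $\mathbf d^\bullet_\circ$-continuous and $\overline{\mathbf d}\leq\underline{\mathbf d}$. A subset $Y$ is \emph{$\mathbf d$-directed} if $\inf_{y\in Y}\sup_{z\in F}z\mathbf dy=0$ for every finite (possibly empty) $F\subseteq Y$, where $\inf\emptyset=\infty$; $x$ is a \emph{$\mathbf d$-maximum} of $Y$ if $y\mathbf dx=0$ for all $y\in Y$ and $\inf_{y\in Y}z\mathbf dy\leq z\mathbf dx$ for all $z$. $X$ is a \emph{$\mathbf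 d$-$\max$-domain} if every $\mathbf d$-directed subset has a $\mathbf d$-maximum, every point is a $\mathbf d$-maximum of some $\mathbf d$-directed subset, and $\overline{\mathbf d}\leq\underline{\mathbf d}$. The space of \emph{formal balls} is $X_+=X\times[0,\infty)$ with $(x,r)\,\mathbf d_+\,(y,s)=(x\mathbf dy-r+s)_+$. \textbf{Theorem.} Let $\mathbf d$ and $\mathbf e$ be distances on a set $X$. Then $$X\text{ is a }\mathbf d^\bullet_\circ\text{-domain and }\mathbf e=\underline{\mathbf d}\iff X_+\text{ is a }<^{\mathbf d_+}\text{-}\max\text{-domain and }\leq^{\mathbf e_+}\;=\;\underline{<^{\mathbf d_+}}.$$ Moreover, if $\mathbf d$ is a hemimetric, then $X$ is $\mathbf d^\bullet_\circ$-complete if and only if $X_+$ is a $<^{\mathbf d_+}$-$\max$-domain. -/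

import Mathlib

open Filter Topology
open scoped ENNReal NNReal

namespace DistanceDomain

universe u v w

/-! ### Generalised relations -/

/-- A generalised relation: a binary function with values in `[0,∞]`. The order on generalised
relations is the pointwise one. -/
abbrev GRel (X : Type u) (Y : Type v) := X → Y → ℝ≥0∞

/-- Composition: `x (a ∘ b) y = inf_z (x a z + z b y)`. -/
noncomputable def GRel.comp {X : Type u} {Z : Type v} {Y : Type w}
    (a : GRel X Z) (b : GRel Z Y) : GRel X Y :=
  fun x y => ⨅ z, a x z + b z y

/-- The classical relation `≤^a`: `x ≤^a y` iff `x a y = 0`. -/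
def GRel.le {X : Type u} {Y : Type v} (a : GRel X Y) (x : X) (y : Y) : Prop :=
  a x y = 0

open Classical in
/-- A classical relation seen as a generalised one, through its `{0,∞}`-valued
characteristic function. -/
noncomputable def GRel.ofRel {X : Type u} {Y : Type v} (r : X → Y → Prop) : GRel X Y :=
  fun x y => if r x y then 0 else ∞

/-- A distance is a generalised relation with the triangle inequality `d ≤ d ∘ d`. -/
def IsDistance {X : Type u} (d : GRel X X) : Prop :=
  d ≤ GRel.comp d d

/-- A hemimetric is a distance `d` for which `≤^d` is reflexive. -/
def IsHemimetric {X : Type u} (d : GRel X X) : Prop :=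
  IsDistance d ∧ ∀ x, d.le x x

/-- The upper hemimetric: `x d̄ z = sup_y (x d y - z d y)₊`. Subtraction in `[0,∞]` is
truncated at `0`, with `∞ - ∞ = 0`. -/
noncomputable def GRel.upperHemi {X : Type u} {Y : Type v} (d : GRel X Y) : GRel X X :=
  fun x z => ⨆ y, (d x y - d z y)

/-- The lower hemimetric: `z d̲ y = sup_x (x d y - x d z)₊`. -/
noncomputable def GRel.lowerHemi {X : Type u} {Y : Type v} (d : GRel X Y) : GRel Y Y :=
  fun z y => ⨆ x, (d x y - d x z)

/-! ### Directed subsets and maxima -/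

/-- `Y` is `d`-directed: `inf_{y ∈ Y} sup_{z ∈ F} z d y = 0` for every finite `F ⊆ Y`. As `F` may
be empty and `inf ∅ = ∞`, such a `Y` is nonempty. -/
def IsDirected {X : Type u} (d : GRel X X) (Y : Set X) : Prop :=
  ∀ F : Finset X, (F : Set X) ⊆ Y → (⨅ y ∈ Y, ⨆ z ∈ F, d z y) = 0

/-- `x` is a `d`-maximum of `Y`: `Y ≤^d x` and `dY ≤ dx`, where `z(dY) = inf_{y ∈ Y} z d y`. -/
def IsMaximum {X : Type u} (d : GRel X X) (x : X) (Y : Set X) : Prop :=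
  (∀ y ∈ Y, d.le y x) ∧ ∀ z, (⨅ y ∈ Y, d z y) ≤ d z x

/-! ### Ball and hole topologies -/

/-- The upper ball `{x | c d x < r}`. -/
def upperBall {X : Type u} (d : GRel X X) (c : X) (r : ℝ≥0∞) : Set X :=
  {x | d c x < r}

/-- The lower hole `{x | c d x > r}`. -/
def lowerHole {X : Type u} (d : GRel X X) (c : X) (r : ℝ≥0∞) : Set X :=
  {x | r < d c x}

/-- The Alexandroff topology, generated by the upper balls. -/
@[reducible] def alexandroff {X : Type u} (d : GRel X X) : TopologicalSpace X :=
  TopologicalSpace.generateFrom {s | ∃ c r, s = upperBall d c r}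

/-- The Smyth topology, generated by the upper balls and the lower holes. -/
@[reducible] def smyth {X : Type u} (d : GRel X X) : TopologicalSpace X :=
  TopologicalSpace.generateFrom
    ({s | ∃ c r, s = upperBall d c r} ∪ {s | ∃ c r, s = lowerHole d c r})

/-- The strict order of `d`: `x <^d y` iff `{z | x ≤^d z}` is a neighbourhood of `y` in the
Alexandroff topology of the lower hemimetric of `d`. -/
def GRel.lt {X : Type u} (d : GRel X X) (x y : X) : Prop :=
  {z | d.le x z} ∈ @nhds X (alexandroff d.lowerHemi) y

/-! ### Nets -/

/-- A net in `X`: a family indexed by a nonempty set with a transitive directed relation, which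
need not be reflexive. -/
structure Net (X : Type u) where
  /-- The index set. -/
  Idx : Type u
  /-- The relation `≺` on indices. -/
  rel : Idx → Idx → Prop
  nonempty : Nonempty Idx
  trans : ∀ {i j k : Idx}, rel i j → rel j k → rel i k
  directed : ∀ i j : Idx, ∃ k, rel i k ∧ rel j k
  /-- The members of the net. -/
  val : Idx → X

/-- The filter of tails of a net: a set of indices is in it iff it contains all `j ≻ i` for
some index `i`. -/
def Net.tails {X : Type u} (s : Net X) : Filter s.Idx where
  sets := {A | ∃ i, ∀ j, s.rel i j → j ∈ A}
  univ_sets := s.nonempty.elim fun i => ⟨i, fun _ _ => Set.mem_univ _⟩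
  sets_of_superset := fun ⟨i, hi⟩ h => ⟨i, fun j hj => h (hi j hj)⟩
  inter_sets := fun ⟨i, hi⟩ ⟨j, hj⟩ => by
    obtain ⟨k, hik, hjk⟩ := s.directed i j
    exact ⟨k, fun l hl => ⟨hi l (s.trans hik hl), hj l (s.trans hjk hl)⟩⟩

/-- The net is `d`-Cauchy: `lim_γ sup_{γ ≺ δ} x_γ d x_δ = 0`. -/
def Net.IsCauchy {X : Type u} (s : Net X) (d : GRel X X) : Prop :=
  Tendsto (fun i => ⨆ j, ⨆ _ : s.rel i j, d (s.val i) (s.val j)) s.tails (𝓝 0)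

/-- Convergence of a net to `x` in the topology `T`. -/
def Net.ConvergesTo {X : Type u} (s : Net X) (T : TopologicalSpace X) (x : X) : Prop :=
  Tendsto s.val s.tails (@nhds X T x)

/-! ### Completeness, continuity and domains -/

/-- `d`-`T`-completeness, for a topology `T`. -/
def TopComplete {X : Type u} (d : GRel X X) (T : TopologicalSpace X) : Prop :=
  ∀ s : Net X, s.IsCauchy d → ∃ x, s.ConvergesTo T x

/-- `d`-`T`-continuity, for a topology `T`. -/
def TopContinuous {X : Type u} (d : GRel X X) (T : TopologicalSpace X) : Prop :=
  ∀ x, ∃ s : Net X, s.IsCauchy d ∧ s.ConvergesTo T x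

/-- `d`-`R`-completeness, for a relation `R` between points and subsets. -/
def RelComplete {X : Type u} (d : GRel X X) (R : X → Set X → Prop) : Prop :=
  ∀ Y : Set X, IsDirected d Y → ∃ x, R x Y

/-- `d`-`R`-continuity, for a relation `R` between points and subsets. -/
def RelContinuous {X : Type u} (d : GRel X X) (R : X → Set X → Prop) : Prop :=
  ∀ x, ∃ Y : Set X, IsDirected d Y ∧ R x Y

/-- A `d`-`T`-predomain. -/
def TopPredomain {X : Type u} (d : GRel X X) (T : TopologicalSpace X) : Prop :=
  TopContinuous d T ∧ d.upperHemi ≤ d.lowerHemi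

/-- A `d`-`T`-domain. -/
def TopDomain {X : Type u} (d : GRel X X) (T : TopologicalSpace X) : Prop :=
  TopComplete d T ∧ TopPredomain d T

/-- A `d`-`R`-predomain. -/
def RelPredomain {X : Type u} (d : GRel X X) (R : X → Set X → Prop) : Prop :=
  RelContinuous d R ∧ d.upperHemi ≤ d.lowerHemi

/-- A `d`-`R`-domain. -/
def RelDomain {X : Type u} (d : GRel X X) (R : X → Set X → Prop) : Prop :=
  RelComplete d R ∧ RelPredomain d R

/-- `X` is Smyth complete: every `d`-Cauchy net has a limit in the Smyth topology of `d`. -/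
def SmythComplete {X : Type u} (d : GRel X X) : Prop :=
  TopComplete d (smyth d)

/-- `X` is a Smyth domain. -/
def SmythDomain {X : Type u} (d : GRel X X) : Prop :=
  TopDomain d (smyth d)

/-- `X` is a `d`-max-domain. -/
def MaxDomain {X : Type u} (d : GRel X X) : Prop :=
  RelDomain d (IsMaximum d)

/-! ### Formal balls -/

/-- The space `X₊ = X × [0,∞)` of formal balls. -/
abbrev FormalBall (X : Type u) := X × ℝ≥0

/-- The distance on formal balls: `(x,r) d₊ (y,s) = (x d y - r + s)₊`. -/
noncomputable def GRel.plus {X : Type u} (d : GRel X X) : GRel (FormalBall X) (FormalBall X) :=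
  fun p q => (d p.1 q.1 + (q.2 : ℝ≥0∞)) - (p.2 : ℝ≥0∞)

end DistanceDomain

/-! The strict order puts `(x, r)` below `(y, s)` exactly when `d x y + s < r` (`plus_lt_iff`), so
directed sets of balls and Cauchy nets encode each other. In a directed set the distances between
centres are bounded by drops in radius, so the centres form a Cauchy net; a Smyth limit of it,
paired with the infimum of the radii, is a maximum (`LtDirected.ltMaximum_of_convergesTo`).
Conversely, giving the points of a Cauchy net all radii above their tail suprema yields a directed
set; its maximum has radius `0` and a Smyth limit as centre (`smythComplete_of_exists_ltMaximum`).

The condition on `e` says that `e` is the lower hemimetric of `d` and that `RadiusAntitone` holds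
(`ofRel_plus_le_eq_iff`). Smyth continuity implies `RadiusAntitone`. In a max-domain,
`RadiusAntitone` gives back continuity: it forces any directed set with maximum `(x, 0)` to have
radii tending to `0` (`infRadius_eq_zero`), so its centres converge to `x`. For a hemimetric,
constant nets make continuity automatic. -/

namespace DistanceDomain

universe u v

/-! ### Characteristic functions of classical relations -/

section Relations

variable {X : Type u} {Y : Type v}

lemma ofRel_eq_zero_iff {r : X → Y → Prop} {x : X} {y : Y} : GRel.ofRel r x y = 0 ↔ r x y := by
  unfold GRel.ofRel; split_ifs with h <;> simp [h]

lemma ofRel_of {r : X → Y → Prop} {x : X} {y : Y} (h : r x y) : GRel.ofRel r x y = 0 :=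
  ofRel_eq_zero_iff.2 h

lemma ofRel_of_not {r : X → Y → Prop} {x : X} {y : Y} (h : ¬ r x y) : GRel.ofRel r x y = ∞ :=
  if_neg h

lemma ofRel_le_ofRel_iff {r s : X → Y → Prop} :
    GRel.ofRel r ≤ GRel.ofRel s ↔ ∀ x y, s x y → r x y := by
  constructor
  · intro h x y hs
    have := h x y
    rw [ofRel_of hs] at this
    exact ofRel_eq_zero_iff.1 (le_antisymm this bot_le)
  · intro h x y
    by_cases hs : s x y
    · rw [ofRel_of (h x y hs)]; exact bot_le
    · rw [ofRel_of_not hs]; exact le_top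

lemma ofRel_inj {r s : X → Y → Prop} :
    GRel.ofRel r = GRel.ofRel s ↔ ∀ x y, r x y ↔ s x y := by
  rw [le_antisymm_iff, ofRel_le_ofRel_iff, ofRel_le_ofRel_iff]
  exact ⟨fun h x y => ⟨h.2 x y, h.1 x y⟩, fun h => ⟨fun x y => (h x y).2, fun x y => (h x y).1⟩⟩

lemma lowerHemi_ofRel (r : X → Y → Prop) :
    (GRel.ofRel r).lowerHemi = GRel.ofRel fun p q => ∀ w, r w p → r w q := by
  funext p q
  unfold GRel.lowerHemi
  by_cases h : ∀ w, r w p → r w q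
  · rw [ofRel_of h, ENNReal.iSup_eq_zero]
    intro w
    by_cases hw : r w p
    · simp [ofRel_of (h w hw)]
    · simp [ofRel_of_not hw]
  · rw [ofRel_of_not h]
    push Not at h
    obtain ⟨w, hp, hq⟩ := h
    refine top_unique (le_iSup_of_le w ?_)
    simp [ofRel_of hp, ofRel_of_not hq]

lemma upperHemi_ofRel (r : X → Y → Prop) :
    (GRel.ofRel r).upperHemi = GRel.ofRel fun p q => ∀ w, r q w → r p w := by
  funext p q
  unfold GRel.upperHemi
  by_cases h : ∀ w, r q w → r p w
  · rw [ofRel_of h, ENNReal.iSup_eq_zero]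
    intro w
    by_cases hw : r q w
    · simp [ofRel_of (h w hw)]
    · simp [ofRel_of_not hw]
  · rw [ofRel_of_not h]
    push Not at h
    obtain ⟨w, hp, hq⟩ := h
    refine top_unique (le_iSup_of_le w ?_)
    simp [ofRel_of hp, ofRel_of_not hq]

/-- With values in `{0, ∞}`, an infimum that is not `∞` is attained with value `0`. -/
lemma isDirected_ofRel {r : X → X → Prop} {Y : Set X} :
    IsDirected (GRel.ofRel r) Y ↔ ∀ F : Finset X, (F : Set X) ⊆ Y → ∃ y ∈ Y, ∀ z ∈ F, r z y := by
  refine forall₂_congr fun F _ => ⟨fun h => ?_, ?_⟩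
  · by_contra! hn
    have : (⨅ y ∈ Y, ⨆ z ∈ F, GRel.ofRel r z y) = ∞ := by
      simp only [iInf_eq_top]
      intro y hy
      obtain ⟨z, hz, hzy⟩ := hn y hy
      exact top_unique (le_iSup₂_of_le z hz (ofRel_of_not hzy).ge)
    simp [this] at h
  · rintro ⟨y, hy, h⟩
    refine le_antisymm (iInf₂_le_of_le y hy (iSup₂_le fun z hz => ?_)) bot_le
    exact (ofRel_of (h z hz)).le

lemma isMaximum_ofRel {r : X → X → Prop} {x : X} {Y : Set X} :
    IsMaximum (GRel.ofRel r) x Y ↔ (∀ y ∈ Y, r y x) ∧ ∀ z, r z x → ∃ y ∈ Y, r z y := by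
  refine and_congr (forall₂_congr fun y _ => ofRel_eq_zero_iff) (forall_congr' fun z => ?_)
  constructor
  · intro h hz
    by_contra! hn
    have : (⨅ y ∈ Y, GRel.ofRel r z y) = ∞ := by
      simp only [iInf_eq_top]
      exact fun y hy => ofRel_of_not (hn y hy)
    simp [this, ofRel_of hz] at h
  · intro h
    by_cases hz : r z x
    · obtain ⟨y, hy, hzy⟩ := h hz
      exact iInf₂_le_of_le y hy ((ofRel_of hzy).le.trans bot_le)
    · rw [ofRel_of_not hz]; exact le_top

end Relations

/-! ### Upper and lower hemimetrics -/

section Hemimetrics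

variable {X : Type u} {d : GRel X X}

lemma IsDistance.triangle (hd : IsDistance d) (x z y : X) : d x y ≤ d x z + d z y :=
  (hd x y).trans (iInf_le _ z)

lemma le_add_lowerHemi (d : GRel X X) (x z y : X) : d x y ≤ d x z + d.lowerHemi z y :=
  tsub_le_iff_left.1 (le_iSup (fun x => d x y - d x z) x)

lemma le_upperHemi_add (d : GRel X X) (x z y : X) : d x y ≤ d.upperHemi x z + d z y :=
  tsub_le_iff_right.1 (le_iSup (fun y => d x y - d z y) y)

lemma lowerHemi_le_iff {z y : X} {a : ℝ≥0∞} :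
    d.lowerHemi z y ≤ a ↔ ∀ c, d c y ≤ d c z + a :=
  iSup_le_iff.trans (forall_congr' fun _ => tsub_le_iff_left)

lemma upperHemi_le_iff {x z : X} {a : ℝ≥0∞} :
    d.upperHemi x z ≤ a ↔ ∀ c, d x c ≤ a + d z c :=
  iSup_le_iff.trans (forall_congr' fun _ => tsub_le_iff_right)

lemma lowerHemi_self (d : GRel X X) (x : X) : d.lowerHemi x x = 0 :=
  le_antisymm (lowerHemi_le_iff.2 fun c => by simp) bot_le

lemma lowerHemi_triangle (d : GRel X X) (x z y : X) :
    d.lowerHemi x y ≤ d.lowerHemi x z + d.lowerHemi z y := by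
  refine lowerHemi_le_iff.2 fun c => (le_add_lowerHemi d c z y).trans ?_
  rw [← add_assoc]
  gcongr
  exact le_add_lowerHemi d c x z

lemma IsDistance.upperHemi_le (hd : IsDistance d) (x y : X) : d.upperHemi x y ≤ d x y :=
  upperHemi_le_iff.2 fun c => hd.triangle x y c

lemma IsHemimetric.le_lowerHemi (hd : IsHemimetric d) (x y : X) : d x y ≤ d.lowerHemi x y := by
  have h := le_add_lowerHemi d x x y
  rwa [show d x x = 0 from hd.2 x, zero_add] at h

/-- The lower hemimetric satisfies the triangle inequality and vanishes on the diagonal for every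
`d`, so any ball containing `y` contains one centred at `y`. -/
lemma mem_nhds_alexandroff_lowerHemi {d : GRel X X} {y : X} {S : Set X} :
    S ∈ @nhds X (alexandroff d.lowerHemi) y ↔ ∃ ε > 0, ∀ z, d.lowerHemi y z < ε → z ∈ S := by
  let := alexandroff d.lowerHemi
  constructor
  · intro h
    obtain ⟨U, hUS, hU, hy⟩ := mem_nhds_iff.1 h
    suffices H : ∃ ε > 0, ∀ z, d.lowerHemi y z < ε → z ∈ U by
      obtain ⟨ε, hε, h⟩ := H
      exact ⟨ε, hε, fun z hz => hUS (h z hz)⟩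
    clear hUS h
    have hU' : TopologicalSpace.GenerateOpen _ U := hU
    clear hU
    induction hU' with
    | basic s hs =>
      obtain ⟨c, r, rfl⟩ := hs
      have hy' : d.lowerHemi c y < r := hy
      refine ⟨r - d.lowerHemi c y, tsub_pos_of_lt hy', fun z hz => ?_⟩
      exact (lowerHemi_triangle d c y z).trans_lt (lt_tsub_iff_left.1 hz)
    | univ => exact ⟨1, one_pos, fun _ _ => trivial⟩
    | inter s t _ _ ihs iht =>
      obtain ⟨a, ha, hs⟩ := ihs hy.1
      obtain ⟨b, hb, ht⟩ := iht hy.2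
      exact ⟨min a b, lt_min ha hb, fun z hz =>
        ⟨hs z (hz.trans_le (min_le_left _ _)), ht z (hz.trans_le (min_le_right _ _))⟩⟩
    | sUnion T _ ih =>
      obtain ⟨t, ht, hyt⟩ := hy
      obtain ⟨ε, hε, h⟩ := ih t ht hyt
      exact ⟨ε, hε, fun z hz => ⟨t, ht, h z hz⟩⟩
  · rintro ⟨ε, hε, h⟩
    refine mem_nhds_iff.2 ⟨upperBall d.lowerHemi y ε, h, ?_, ?_⟩
    · exact TopologicalSpace.GenerateOpen.basic _ ⟨y, ε, rfl⟩
    · show d.lowerHemi y y < ε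
      rwa [lowerHemi_self]

end Hemimetrics

/-! ### The orders on formal balls -/

section FormalBalls

variable {X : Type u} {d : GRel X X}

lemma plus_le_iff (p q : FormalBall X) : d.plus.le p q ↔ d p.1 q.1 + q.2 ≤ p.2 :=
  tsub_eq_zero_iff_le

/-- A formal ball is strictly below another iff it strictly contains it. -/
lemma plus_lt_iff (p q : FormalBall X) : d.plus.lt p q ↔ d p.1 q.1 + q.2 < p.2 := by
  unfold GRel.lt
  rw [mem_nhds_alexandroff_lowerHemi]
  constructor
  · rintro ⟨ε, hε, h⟩
    obtain ⟨δ, hδ, hδε⟩ := ENNReal.lt_iff_exists_nnreal_btwn.1 hε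
    -- Enlarging the radius of `q` by `δ` moves it by at most `δ` in the lower hemimetric; staying
    -- above `p` after this gives the strict inequality.
    have h1 := h (q.1, q.2 + δ) (lt_of_le_of_lt (lowerHemi_le_iff.2 fun c => ?_) hδε)
    · have h2 := (plus_le_iff _ _).1 h1
      simp only [ENNReal.coe_add] at h2
      refine lt_of_lt_of_le ?_ (le_of_eq_of_le (add_assoc _ _ _) h2)
      refine ENNReal.lt_add_right (ne_top_of_le_ne_top (ENNReal.coe_ne_top (r := p.2)) ?_) hδ.ne'
      exact le_trans (by gcongr; exact le_self_add) h2
    · unfold GRel.plus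
      simp only [ENNReal.coe_add, ← add_assoc]
      rw [tsub_le_iff_right]
      exact (add_le_add le_tsub_add le_rfl).trans_eq (add_right_comm _ _ _)
  · intro h
    refine ⟨p.2 - (d p.1 q.1 + q.2), tsub_pos_of_lt h, fun z hz => (plus_le_iff _ _).2 ?_⟩
    -- Against radius `0` the truncation in `d.plus` disappears.
    have h1 := le_add_lowerHemi d.plus (p.1, 0) q z
    simp only [GRel.plus, ENNReal.coe_zero, tsub_zero] at h1
    exact h1.trans (lt_tsub_iff_left.1 hz).le

/-- The strict order on formal balls. -/
def Lt (d : GRel X X) (p q : FormalBall X) : Prop := d p.1 q.1 + q.2 < p.2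

lemma plus_lt_eq : d.plus.lt = Lt d := by
  funext p q; exact propext (plus_lt_iff p q)

lemma Lt.radius_lt {p q : FormalBall X} (h : Lt d p q) : q.2 < p.2 :=
  ENNReal.coe_lt_coe.1 (le_add_self.trans_lt h)

lemma Lt.dist_lt {p q : FormalBall X} (h : Lt d p q) : d p.1 q.1 < p.2 :=
  le_self_add.trans_lt h

lemma IsDistance.lt_of_le_of_lt (hd : IsDistance d) {p q w : FormalBall X}
    (h : d p.1 q.1 + q.2 ≤ p.2) (h' : Lt d q w) : Lt d p w := by
  have h1 : d p.1 q.1 ≠ ∞ :=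
    ne_top_of_le_ne_top ENNReal.coe_ne_top (le_self_add.trans h)
  calc d p.1 w.1 + w.2 ≤ d p.1 q.1 + (d q.1 w.1 + w.2) := by
        rw [← add_assoc]; gcongr; exact hd.triangle _ _ _
    _ < d p.1 q.1 + q.2 := ENNReal.add_lt_add_left h1 h'
    _ ≤ p.2 := h

lemma IsDistance.lt_trans (hd : IsDistance d) {p q w : FormalBall X}
    (h : Lt d p q) (h' : Lt d q w) : Lt d p w :=
  hd.lt_of_le_of_lt h.le h'

/-- Predecessors in the strict order on formal balls. -/
lemma forall_lt_imp_lt_iff {p q : FormalBall X} :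
    (∀ w, Lt d w p → Lt d w q) ↔ ∀ c, d c q.1 + q.2 ≤ d c p.1 + p.2 := by
  constructor
  · intro h c
    refine le_of_forall_gt fun t ht => ?_
    obtain ⟨t', ht', htt'⟩ := ENNReal.lt_iff_exists_nnreal_btwn.1 ht
    exact (h (c, t') ht').trans htt'
  · exact fun h w hw => (h w.1).trans_lt hw

/-- Formal balls with more predecessors in the strict order have smaller radii. -/
def RadiusAntitone (d : GRel X X) : Prop :=
  ∀ p q : FormalBall X, (∀ w, Lt d w p → Lt d w q) → q.2 ≤ p.2

/-- The lower hemimetric is a supremum of positive parts, so it retains no sign of `p.2 - q.2`;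
`RadiusAntitone` supplies the missing comparison of radii. -/
lemma lowerHemi_add_le_iff (h : RadiusAntitone d) {p q : FormalBall X} :
    d.lowerHemi p.1 q.1 + q.2 ≤ p.2 ↔ ∀ w, Lt d w p → Lt d w q := by
  refine ⟨fun h' => forall_lt_imp_lt_iff.2 fun c => ?_, fun h' => ?_⟩
  · calc d c q.1 + q.2 ≤ d c p.1 + d.lowerHemi p.1 q.1 + q.2 := by
          gcongr; exact le_add_lowerHemi _ _ _ _
      _ ≤ d c p.1 + p.2 := by rw [add_assoc]; gcongr
  · have hr : (q.2 : ℝ≥0∞) ≤ p.2 := ENNReal.coe_le_coe.2 (h p q h')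
    have : d.lowerHemi p.1 q.1 ≤ p.2 - q.2 := lowerHemi_le_iff.2 fun c => by
      have := forall_lt_imp_lt_iff.1 h' c
      rw [← ENNReal.add_le_add_iff_right (ENNReal.coe_ne_top (r := q.2)), add_assoc,
        tsub_add_cancel_of_le hr]
      exact this
    calc _ ≤ (p.2 - q.2 : ℝ≥0∞) + q.2 := by gcongr
      _ = p.2 := tsub_add_cancel_of_le hr

lemma ofRel_plus_le_eq_iff {e : GRel X X} :
    GRel.ofRel e.plus.le = (GRel.ofRel (Lt d)).lowerHemi ↔
      e = d.lowerHemi ∧ RadiusAntitone d := by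
  rw [lowerHemi_ofRel, ofRel_inj]
  simp only [plus_le_iff]
  constructor
  · intro h
    refine ⟨?_, fun p q hpq => ENNReal.coe_le_coe.1 (le_add_self.trans ((h p q).2 hpq))⟩
    funext x y
    refine eq_of_forall_ge_iff fun r => ?_
    induction r using ENNReal.recTopCoe with
    | top => simp
    | coe r =>
      -- Target radius `0` recovers `e x y` from its finite upper bounds `r`.
      have := h (x, r) (y, 0)
      rw [forall_lt_imp_lt_iff] at this
      simpa [lowerHemi_le_iff] using this
  · rintro ⟨rfl, h⟩ p q
    exact lowerHemi_add_le_iff h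

end FormalBalls

/-! ### Cauchy nets and Smyth convergence -/

section Nets

variable {X : Type u} {d : GRel X X}

instance (s : Net X) : s.tails.NeBot := by
  refine ⟨fun h => ?_⟩
  have : (∅ : Set s.Idx) ∈ s.tails := by rw [h]; trivial
  obtain ⟨i, hi⟩ := this
  obtain ⟨k, hk, _⟩ := s.directed i i
  exact hi k hk

lemma Net.eventually_rel (s : Net X) (i : s.Idx) : ∀ᶠ j in s.tails, s.rel i j :=
  ⟨i, fun _ h => h⟩

lemma Net.convergesTo_smyth_iff (s : Net X) (x : X) :
    s.ConvergesTo (smyth d) x ↔ ∀ c, Tendsto (fun i => d c (s.val i)) s.tails (𝓝 (d c x)) := by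
  unfold Net.ConvergesTo smyth
  rw [TopologicalSpace.tendsto_nhds_generateFrom_iff]
  constructor
  · intro h c
    refine tendsto_order.2 ⟨fun a ha => ?_, fun a ha => ?_⟩
    · exact h (lowerHole d c a) (Or.inr ⟨c, a, rfl⟩) ha
    · exact h (upperBall d c a) (Or.inl ⟨c, a, rfl⟩) ha
  · rintro h _ (⟨c, a, rfl⟩ | ⟨c, a, rfl⟩) hx
    · exact (tendsto_order.1 (h c)).2 a hx
    · exact (tendsto_order.1 (h c)).1 a hx

lemma Net.isCauchy_iff (s : Net X) :
    s.IsCauchy d ↔ ∀ ε > 0, ∀ᶠ i in s.tails, (⨆ j, ⨆ _ : s.rel i j, d (s.val i) (s.val j)) < ε := by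
  unfold Net.IsCauchy
  simp only [tendsto_order, not_lt_bot, ← bot_eq_zero, IsEmpty.forall_iff, implies_true, true_and]

/-- Limits of Cauchy nets are approached with distance tending to zero. -/
lemma Net.IsCauchy.exists_small {s : Net X} (hs : s.IsCauchy d) {x : X}
    (hx : s.ConvergesTo (smyth d) x) {ε : ℝ≥0∞} (hε : 0 < ε) :
    ∀ᶠ i in s.tails, d (s.val i) x < ε := by
  filter_upwards [s.isCauchy_iff.1 hs ε hε] with i hi
  refine lt_of_le_of_lt (le_of_tendsto ((s.convergesTo_smyth_iff x).1 hx (s.val i)) ?_) hi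
  filter_upwards [s.eventually_rel i] with j hj
  exact le_iSup₂_of_le j hj le_rfl

/-- A net converges to `x` in the Smyth topology as soon as it approaches `x` from below and its
upper distances do not exceed those of `x`. -/
lemma Net.convergesTo_smyth_of (hd : IsDistance d) (s : Net X) {x : X}
    (h₀ : ∀ ε > 0, ∀ᶠ i in s.tails, d (s.val i) x < ε)
    (h₁ : ∀ c, ∀ t : ℝ≥0, d c x < t → ∀ᶠ i in s.tails, d c (s.val i) < t) :
    s.ConvergesTo (smyth d) x := by
  refine (s.convergesTo_smyth_iff x).2 fun c => tendsto_order.2 ⟨fun a ha => ?_, fun a ha => ?_⟩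
  -- Lower bounds come from the triangle inequality through `s.val i`.
  · filter_upwards [h₀ (d c x - a) (tsub_pos_of_lt ha)] with i hi
    by_contra! hn
    have h1 : d c x ≤ a + d (s.val i) x := (hd.triangle c (s.val i) x).trans (by gcongr)
    exact absurd hi (tsub_le_iff_left.2 h1).not_gt
  · obtain ⟨t, ht, hta⟩ := ENNReal.lt_iff_exists_nnreal_btwn.1 ha
    filter_upwards [h₁ c t ht] with i hi using hi.trans hta

end Nets

/-! ### Directed sets of balls and their nets of centres -/

section DirectedSets

variable {X : Type u} {d : GRel X X} {Y : Set (FormalBall X)}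

/-- Directedness with respect to the strict order on formal balls. -/
def LtDirected (d : GRel X X) (Y : Set (FormalBall X)) : Prop :=
  ∀ F : Finset (FormalBall X), (F : Set (FormalBall X)) ⊆ Y → ∃ y ∈ Y, ∀ z ∈ F, Lt d z y

/-- Maxima with respect to the strict order on formal balls. -/
def LtMaximum (d : GRel X X) (p : FormalBall X) (Y : Set (FormalBall X)) : Prop :=
  (∀ y ∈ Y, Lt d y p) ∧ ∀ z, Lt d z p → ∃ y ∈ Y, Lt d z y

lemma maxDomain_iff : MaxDomain (GRel.ofRel d.plus.lt) ↔
    (∀ Y, LtDirected d Y → ∃ p, LtMaximum d p Y) ∧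
    (∀ p, ∃ Y, LtDirected d Y ∧ LtMaximum d p Y) ∧
    ∀ p q, (∀ w, Lt d w p → Lt d w q) → ∀ w, Lt d q w → Lt d p w := by
  rw [plus_lt_eq]
  unfold MaxDomain RelDomain RelPredomain RelComplete RelContinuous
  rw [lowerHemi_ofRel, upperHemi_ofRel, ofRel_le_ofRel_iff]
  simp only [isDirected_ofRel, isMaximum_ofRel]
  rfl

lemma LtDirected.nonempty (hY : LtDirected d Y) : Y.Nonempty := by
  obtain ⟨y, hy, _⟩ := hY ∅ (by simp)
  exact ⟨y, hy⟩

lemma LtDirected.exists_gt (hY : LtDirected d Y) {y z : FormalBall X} (hy : y ∈ Y) (hz : z ∈ Y) :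
    ∃ w ∈ Y, Lt d y w ∧ Lt d z w := by
  classical
  obtain ⟨w, hw, h⟩ := hY {y, z} (by simp [Set.insert_subset_iff, hy, hz])
  exact ⟨w, hw, h y (by simp), h z (by simp)⟩

/-- The net of centres of a directed set of formal balls. -/
def LtDirected.net (hY : LtDirected d Y) (hd : IsDistance d) : Net X where
  Idx := Y
  rel y z := Lt d y z
  nonempty := hY.nonempty.to_subtype
  trans := hd.lt_trans
  directed y z := by
    obtain ⟨w, hw, h⟩ := hY.exists_gt y.2 z.2
    exact ⟨⟨w, hw⟩, h⟩
  val y := y.1.1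

/-- The infimum of the radii. -/
noncomputable def infRadius (Y : Set (FormalBall X)) : ℝ≥0 := sInf (Prod.snd '' Y)

lemma infRadius_le {y : FormalBall X} (hy : y ∈ Y) : infRadius Y ≤ y.2 :=
  csInf_le (OrderBot.bddBelow _) ⟨y, hy, rfl⟩

lemma exists_radius_lt (hY : Y.Nonempty) {t : ℝ≥0} (ht : infRadius Y < t) :
    ∃ y ∈ Y, y.2 < t := by
  obtain ⟨_, ⟨y, hy, rfl⟩, h⟩ := exists_lt_of_csInf_lt (hY.image _) ht
  exact ⟨y, hy, h⟩

lemma LtDirected.eventually_radius_lt (hY : LtDirected d Y) (hd : IsDistance d) {t : ℝ≥0}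
    (ht : infRadius Y < t) : ∀ᶠ y : Y in (hY.net hd).tails, y.1.2 < t := by
  obtain ⟨y, hy, h⟩ := exists_radius_lt hY.nonempty ht
  filter_upwards [(hY.net hd).eventually_rel ⟨y, hy⟩] with z hz
  exact (Lt.radius_lt hz).trans h

lemma LtDirected.net_isCauchy (hY : LtDirected d Y) (hd : IsDistance d) :
    (hY.net hd).IsCauchy d := by
  refine (Net.isCauchy_iff _).2 fun ε hε => ?_
  obtain ⟨δ, hδ, hδε⟩ := ENNReal.lt_iff_exists_nnreal_btwn.1 hε
  have hδ' : infRadius Y < infRadius Y + δ := lt_add_of_pos_right _ (by exact_mod_cast hδ)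
  filter_upwards [hY.eventually_radius_lt hd hδ'] with y hy
  refine lt_of_le_of_lt (iSup₂_le fun z hz => ?_) hδε
  have h1 : d y.1.1 z.1.1 + z.1.2 < y.1.2 := hz
  have h2 : d y.1.1 z.1.1 + infRadius Y ≤ δ + infRadius Y := by
    calc d y.1.1 z.1.1 + infRadius Y ≤ d y.1.1 z.1.1 + z.1.2 := by
          gcongr; exact infRadius_le z.2
      _ ≤ y.1.2 := h1.le
      _ ≤ δ + infRadius Y := by rw [add_comm]; exact_mod_cast hy.le
  exact (ENNReal.add_le_add_iff_right ENNReal.coe_ne_top).1 h2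

/-- A Smyth limit of the centres together with the infimum of the radii is a maximum. -/
lemma LtDirected.ltMaximum_of_convergesTo (hY : LtDirected d Y) (hd : IsDistance d) {x : X}
    (hx : (hY.net hd).ConvergesTo (smyth d) x) : LtMaximum d (x, infRadius Y) Y := by
  rw [Net.convergesTo_smyth_iff] at hx
  refine ⟨fun y hy => ?_, fun z hz => ?_⟩
  -- Passing to the limit only preserves `≤`; the intermediate `y'` restores strictness.
  · obtain ⟨y', hy', h, -⟩ := hY.exists_gt hy hy
    refine lt_of_le_of_lt ?_ h
    refine le_of_tendsto ((hx y.1).add_const (infRadius Y : ℝ≥0∞)) ?_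
    filter_upwards [(hY.net hd).eventually_rel ⟨y', hy'⟩] with w hw
    have hw : d y'.1 w.1.1 + w.1.2 < y'.2 := hw
    calc d y.1 w.1.1 + infRadius Y ≤ d y.1 y'.1 + d y'.1 w.1.1 + w.1.2 := by
          gcongr
          · exact hd.triangle _ _ _
          · exact infRadius_le w.2
      _ ≤ d y.1 y'.1 + y'.2 := by rw [add_assoc]; gcongr
  · have hz : d z.1 x + infRadius Y < z.2 := hz
    -- The slack is split: `a` bounds the distance to the centres, `z.2 - a` the radii.
    obtain ⟨a, ha, haz⟩ := ENNReal.lt_iff_exists_nnreal_btwn.1 (lt_tsub_iff_right.2 hz)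
    have h1 : infRadius Y < z.2 - a := by
      rw [lt_tsub_iff_left]
      exact_mod_cast lt_tsub_iff_right.1 haz
    obtain ⟨y, hy1, hy2⟩ :=
      (((tendsto_order.1 (hx z.1)).2 _ ha).and (hY.eventually_radius_lt hd h1)).exists
    refine ⟨y.1, y.2, ?_⟩
    have h2 : (a : ℝ≥0∞) + y.1.2 < z.2 := by exact_mod_cast lt_tsub_iff_left.1 hy2
    exact lt_of_le_of_lt (by gcongr; exact hy1.le) h2

end DirectedSets

/-! ### From Smyth domains to max-domains -/

section SmythToMax

variable {X : Type u} {d : GRel X X}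

lemma SmythComplete.exists_ltMaximum (h : SmythComplete d) (hd : IsDistance d)
    {Y : Set (FormalBall X)} (hY : LtDirected d Y) : ∃ p, LtMaximum d p Y := by
  obtain ⟨x, hx⟩ := h _ (hY.net_isCauchy hd)
  exact ⟨_, hY.ltMaximum_of_convergesTo hd hx⟩

/-- Some net point lies within `ε` of `p.1`; comparing predecessors centred there gives `q.2 ≤ p.2 +
ε`. -/
lemma radiusAntitone_of_topContinuous (h : TopContinuous d (smyth d)) : RadiusAntitone d := by
  intro p q hpq
  obtain ⟨s, hs, hx⟩ := h p.1
  refine le_of_forall_pos_le_add fun ε hε => ?_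
  obtain ⟨i, hi⟩ := (hs.exists_small hx (ENNReal.coe_pos.2 hε)).exists
  have := forall_lt_imp_lt_iff.1 hpq (s.val i)
  have h2 : (q.2 : ℝ≥0∞) ≤ p.2 + ε := by
    calc (q.2 : ℝ≥0∞) ≤ d (s.val i) p.1 + p.2 := le_add_self.trans this
      _ ≤ p.2 + ε := by rw [add_comm]; gcongr
  exact_mod_cast h2

/-- Finitely many strict inequalities share a slack `δ`. Replacing `p` by `(s.val i, p.2 + δ)` for a
late `i` uses this slack above `F` and stays strictly below `p`. -/
lemma ltDirected_predecessors (h : TopContinuous d (smyth d)) (p : FormalBall X) :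
    LtDirected d {w | Lt d w p} := by
  intro F hF
  obtain ⟨s, hs, hx⟩ := h p.1
  have hx' := (s.convergesTo_smyth_iff p.1).1 hx
  obtain ⟨δ, hδ, hF'⟩ : ∃ δ : ℝ≥0, 0 < δ ∧ ∀ w ∈ F, d w.1 p.1 + (p.2 + δ : ℝ≥0) < w.2 := by
    have H : ∀ᶠ δ : ℝ≥0 in 𝓝[>] 0, ∀ w ∈ F, d w.1 p.1 + (p.2 + δ : ℝ≥0) < w.2 := by
      refine (Finset.eventually_all F).2 fun w hw => ?_
      have hw : d w.1 p.1 + p.2 < w.2 := hF hw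
      obtain ⟨a, ha, haw⟩ := ENNReal.lt_iff_exists_nnreal_btwn.1 (tsub_pos_of_lt hw)
      filter_upwards [Ioo_mem_nhdsGT (ENNReal.coe_pos.1 ha)] with δ hδ
      have : (δ : ℝ≥0∞) < w.2 - (d w.1 p.1 + p.2) :=
        (ENNReal.coe_lt_coe.2 hδ.2).trans haw
      rw [ENNReal.coe_add, ← add_assoc]
      exact lt_tsub_iff_left.1 this
    obtain ⟨δ, h1, h2⟩ := (H.and self_mem_nhdsWithin).exists
    exact ⟨δ, h2, h1⟩
  have E1 : ∀ᶠ i in s.tails, ∀ w ∈ F, d w.1 (s.val i) + (p.2 + δ : ℝ≥0) < w.2 :=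
    (Finset.eventually_all F).2 fun w hw =>
      (tendsto_order.1 ((hx' w.1).add_const _)).2 _ (hF' w hw)
  obtain ⟨i, h1, h2⟩ := (E1.and (hs.exists_small hx (ENNReal.coe_pos.2 hδ))).exists
  refine ⟨(s.val i, p.2 + δ), ?_, h1⟩
  show d (s.val i) p.1 + p.2 < (p.2 + δ : ℝ≥0)
  rw [ENNReal.coe_add, add_comm]
  exact ENNReal.add_lt_add_left ENNReal.coe_ne_top h2

lemma ltMaximum_predecessors (h : TopContinuous d (smyth d)) (p : FormalBall X) :
    LtMaximum d p {w | Lt d w p} := by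
  refine ⟨fun _ h => h, fun z hz => ?_⟩
  obtain ⟨y, hy, hzy⟩ := ltDirected_predecessors h p {z} (by simpa using hz)
  exact ⟨y, hy, hzy z (by simp)⟩

lemma SmythDomain.maxDomain (h : SmythDomain d) (hd : IsDistance d) :
    MaxDomain (GRel.ofRel d.plus.lt) := by
  obtain ⟨hcomp, hcont, hUL⟩ := h
  refine maxDomain_iff.2 ⟨fun Y hY => SmythComplete.exists_ltMaximum hcomp hd hY,
    fun p => ⟨_, ltDirected_predecessors hcont p, ltMaximum_predecessors hcont p⟩,
    fun p q hpq w hqw => ?_⟩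
  have h1 := (lowerHemi_add_le_iff (radiusAntitone_of_topContinuous hcont)).2 hpq
  have h2 : d.upperHemi p.1 q.1 + q.2 ≤ p.2 := le_trans (by gcongr; exact hUL _ _) h1
  have h3 : d.upperHemi p.1 q.1 ≠ ∞ :=
    ne_top_of_le_ne_top ENNReal.coe_ne_top (le_self_add.trans h2)
  calc d p.1 w.1 + w.2 ≤ d.upperHemi p.1 q.1 + (d q.1 w.1 + w.2) := by
        rw [← add_assoc]; gcongr; exact le_upperHemi_add _ _ _ _
    _ < d.upperHemi p.1 q.1 + q.2 := ENNReal.add_lt_add_left h3 hqw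
    _ ≤ p.2 := h2

end SmythToMax

/-! ### From max-domains to Smyth domains -/

section MaxToSmyth

variable {X : Type u} {d : GRel X X}

lemma upperHemi_le_lowerHemi_of_lt
    (h : ∀ p q, (∀ w, Lt d w p → Lt d w q) → ∀ w, Lt d q w → Lt d p w) :
    d.upperHemi ≤ d.lowerHemi := by
  intro x y
  rcases eq_or_ne (d.lowerHemi x y) ∞ with hL | hL
  · rw [hL]; exact le_top
  lift d.lowerHemi x y to ℝ≥0 using hL with a ha
  refine upperHemi_le_iff.2 fun c => le_of_forall_gt fun t ht => ?_
  obtain ⟨s, hs, hst⟩ := ENNReal.lt_iff_exists_nnreal_btwn.1 (lt_tsub_iff_left.2 ht)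
  -- Here `a` is the lower hemimetric from `x` to `y`, and `s` lies strictly between `d y c` and `t
  -- - a`.
  have H := h (x, a + s) (y, s) (forall_lt_imp_lt_iff.2 fun c => ?_) (c, 0) ?_
  · have H : d x c + (0 : ℝ≥0) < (a + s : ℝ≥0) := H
    rw [ENNReal.coe_zero, add_zero, ENNReal.coe_add] at H
    exact H.trans (lt_tsub_iff_left.1 hst)
  · simp only [ENNReal.coe_add, ← add_assoc]
    gcongr
    rw [ha]
    exact le_add_lowerHemi _ _ _ _
  · show d y c + (0 : ℝ≥0) < s
    simpa using hs

lemma smythComplete_of_exists_ltMaximum (hd : IsDistance d)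
    (h : ∀ Y, LtDirected d Y → ∃ p, LtMaximum d p Y) : SmythComplete d := by
  intro s hs
  rw [Net.isCauchy_iff] at hs
  let R : s.Idx → ℝ≥0∞ := fun i => ⨆ j, ⨆ _ : s.rel i j, d (s.val i) (s.val j)
  have hR : ∀ {i j}, s.rel i j → d (s.val i) (s.val j) ≤ R i := fun {i j} hij =>
    le_iSup₂ (f := fun j (_ : s.rel i j) => d (s.val i) (s.val j)) j hij
  -- The strict bound on `R i` leaves the slack that directedness needs.
  let Y : Set (FormalBall X) := {p | ∃ i, p.1 = s.val i ∧ R i < p.2}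
  have hmem : ∀ {i} {t : ℝ≥0}, R i < t → (s.val i, t) ∈ Y := fun h => ⟨_, rfl, h⟩
  have hY : LtDirected d Y := by
    intro F hF
    obtain ⟨δ, hδ, hF'⟩ : ∃ δ : ℝ≥0, 0 < δ ∧
        ∀ w ∈ F, ∃ i, w.1 = s.val i ∧ R i + δ < w.2 := by
      have H : ∀ᶠ δ : ℝ≥0 in 𝓝[>] 0, ∀ w ∈ F, ∃ i, w.1 = s.val i ∧ R i + δ < w.2 := by
        refine (Finset.eventually_all F).2 fun w hw => ?_
        obtain ⟨i, hwi, hi⟩ := hF hw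
        obtain ⟨a, ha, haw⟩ := ENNReal.lt_iff_exists_nnreal_btwn.1 (tsub_pos_of_lt hi)
        filter_upwards [Ioo_mem_nhdsGT (ENNReal.coe_pos.1 ha)] with δ hδ
        exact ⟨i, hwi, lt_tsub_iff_left.1 ((ENNReal.coe_lt_coe.2 hδ.2).trans haw)⟩
      obtain ⟨δ, h1, h2⟩ := (H.and self_mem_nhdsWithin).exists
      exact ⟨δ, h2, h1⟩
    have := s.nonempty
    choose! f hf1 hf2 using hF'
    have E1 : ∀ᶠ k in s.tails, ∀ w ∈ F, s.rel (f w) k :=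
      (Finset.eventually_all F).2 fun w _ => s.eventually_rel (f w)
    obtain ⟨k, h1, h2⟩ := (E1.and (hs δ (ENNReal.coe_pos.2 hδ))).exists
    refine ⟨(s.val k, δ), hmem h2, fun w hw => ?_⟩
    show d w.1 (s.val k) + δ < w.2
    rw [hf1 w hw]
    exact lt_of_le_of_lt (by gcongr; exact hR (h1 w hw)) (hf2 w hw)
  obtain ⟨p, hp⟩ := h Y hY
  refine ⟨p.1, s.convergesTo_smyth_of hd (fun ε hε => ?_) fun c t hct => ?_⟩
  · obtain ⟨δ, hδ, hδε⟩ := ENNReal.lt_iff_exists_nnreal_btwn.1 hε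
    filter_upwards [hs δ hδ] with i hi
    exact (hp.1 _ (hmem hi)).dist_lt.trans hδε
  -- `Y` contains balls of arbitrarily small radius, all strictly below `p`.
  · have hp0 : p.2 = 0 := by
      refine nonpos_iff_eq_zero.1 (le_of_forall_gt fun t ht => ?_)
      obtain ⟨i, hi⟩ := (hs t (ENNReal.coe_pos.2 ht)).exists
      exact (hp.1 _ (hmem hi)).radius_lt
    obtain ⟨y, ⟨i, hyi, hi⟩, hy⟩ := hp.2 (c, t) (by simpa [Lt, hp0] using hct)
    have hy : d c y.1 + y.2 < t := hy
    rw [hyi] at hy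
    filter_upwards [s.eventually_rel i] with j hj
    calc d c (s.val j) ≤ d c (s.val i) + d (s.val i) (s.val j) := hd.triangle _ _ _
      _ ≤ d c (s.val i) + y.2 := by gcongr; exact (hR hj).trans hi.le
      _ < t := hy

/-- Lowering all radii by `a = infRadius Y` keeps `Y` directed. Raising the radius of a maximum `z`
of the shifted set by `a` gives a ball above `Y`, hence with all predecessors of `(x, 0)`;
`RadiusAntitone` then yields `z.2 + a ≤ 0`. -/
lemma infRadius_eq_zero (hd : IsDistance d) (hA : RadiusAntitone d)
    (hcomp : ∀ Y, LtDirected d Y → ∃ p, LtMaximum d p Y) {x : X} {Y : Set (FormalBall X)}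
    (hY : LtDirected d Y) (hx : LtMaximum d (x, 0) Y) : infRadius Y = 0 := by
  classical
  set a := infRadius Y with ha
  let σ : FormalBall X → FormalBall X := fun p => (p.1, p.2 - a)
  -- No bound on `p.2` is needed: if `p.2 < a`, both sides are false.
  have hσ : ∀ {p q : FormalBall X}, a ≤ q.2 → (Lt d (σ p) (σ q) ↔ Lt d p q) := by
    intro p q hq
    show d p.1 q.1 + ((q.2 - a : ℝ≥0) : ℝ≥0∞) < ((p.2 - a : ℝ≥0) : ℝ≥0∞) ↔ d p.1 q.1 + q.2 < p.2
    rw [ENNReal.coe_sub, ENNReal.coe_sub, lt_tsub_iff_right, add_assoc,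
      tsub_add_cancel_of_le (ENNReal.coe_le_coe.2 hq)]
  have hZ : LtDirected d (σ '' Y) := by
    intro F hF
    obtain ⟨G, hG, rfl⟩ := Finset.subset_set_image_iff.1 hF
    obtain ⟨y, hy, h⟩ := hY G hG
    refine ⟨σ y, ⟨y, hy, rfl⟩, fun z hz => ?_⟩
    obtain ⟨w, hw, rfl⟩ := Finset.mem_image.1 hz
    exact (hσ (infRadius_le hy)).2 (h w hw)
  obtain ⟨z, hz⟩ := hcomp _ hZ
  refine nonpos_iff_eq_zero.1 (le_trans ?_ (hA (x, 0) (z.1, z.2 + a) fun w hw => ?_))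
  · exact le_add_self
  · obtain ⟨y, hy, hwy⟩ := hx.2 w hw
    have h1 : Lt d (σ y) (σ (z.1, z.2 + a)) := by
      simpa [σ] using hz.1 (σ y) ⟨y, hy, rfl⟩
    exact hd.lt_trans hwy ((hσ le_add_self).1 h1)

lemma topContinuous_of_ltMaximum (hd : IsDistance d) (hA : RadiusAntitone d)
    (hcomp : ∀ Y, LtDirected d Y → ∃ p, LtMaximum d p Y)
    (hcont : ∀ p, ∃ Y, LtDirected d Y ∧ LtMaximum d p Y) : TopContinuous d (smyth d) := by
  intro x
  obtain ⟨Y, hY, hx⟩ := hcont (x, 0)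
  have h0 := infRadius_eq_zero hd hA hcomp hY hx
  refine ⟨hY.net hd, hY.net_isCauchy hd,
    (hY.net hd).convergesTo_smyth_of hd (fun ε hε => ?_) fun c t hct => ?_⟩
  · obtain ⟨δ, hδ, hδε⟩ := ENNReal.lt_iff_exists_nnreal_btwn.1 hε
    filter_upwards [hY.eventually_radius_lt hd (h0.trans_lt (ENNReal.coe_pos.1 hδ))] with y hy
    exact ((hx.1 y.1 y.2).dist_lt.trans (ENNReal.coe_lt_coe.2 hy)).trans hδε
  · obtain ⟨y, hy, hcy⟩ := hx.2 (c, t) (by simpa [Lt] using hct)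
    filter_upwards [(hY.net hd).eventually_rel ⟨y, hy⟩] with z hz
    exact (hd.lt_trans hcy hz).dist_lt

lemma smythDomain_of_maxDomain (hd : IsDistance d) (hA : RadiusAntitone d)
    (h : MaxDomain (GRel.ofRel d.plus.lt)) : SmythDomain d := by
  obtain ⟨hcomp, hcont, hUL⟩ := maxDomain_iff.1 h
  exact ⟨smythComplete_of_exists_ltMaximum hd hcomp,
    topContinuous_of_ltMaximum hd hA hcomp hcont, upperHemi_le_lowerHemi_of_lt hUL⟩

end MaxToSmyth

/-! ### The hemimetric case -/

section Hemimetric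

variable {X : Type u} {d : GRel X X}

lemma IsHemimetric.topContinuous (hd : IsHemimetric d) : TopContinuous d (smyth d) := by
  intro x
  let s : Net X :=
    { Idx := PUnit, rel := fun _ _ => True, nonempty := inferInstance,
      trans := fun _ _ => trivial, directed := fun _ _ => ⟨⟨⟩, trivial, trivial⟩,
      val := fun _ => x }
  have hx : d x x = 0 := hd.2 x
  refine ⟨s, ?_, ?_⟩
  · rw [Net.isCauchy_iff]
    intro ε hε
    simpa [s, hx] using .of_forall fun _ => hε
  · rw [Net.convergesTo_smyth_iff]
    exact fun c => tendsto_const_nhds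

lemma IsHemimetric.smythDomain_iff (hd : IsHemimetric d) : SmythDomain d ↔ SmythComplete d :=
  ⟨fun h => h.1, fun h => ⟨h, hd.topContinuous, fun x y =>
    (hd.1.upperHemi_le x y).trans (hd.le_lowerHemi x y)⟩⟩

end Hemimetric

end DistanceDomain

open DistanceDomain in
theorem mainTheorem1 {X : Type*} (d e : DistanceDomain.GRel X X)
    (hd : DistanceDomain.IsDistance d) (he : DistanceDomain.IsDistance e) :
    ((DistanceDomain.SmythDomain d ∧ e = d.lowerHemi) ↔
      (DistanceDomain.MaxDomain (DistanceDomain.GRel.ofRel d.plus.lt) ∧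
        DistanceDomain.GRel.ofRel e.plus.le =
          (DistanceDomain.GRel.ofRel d.plus.lt).lowerHemi)) ∧
    (DistanceDomain.IsHemimetric d →
      (DistanceDomain.SmythComplete d ↔
        DistanceDomain.MaxDomain (DistanceDomain.GRel.ofRel d.plus.lt))) := by
  constructor
  · constructor
    · rintro ⟨h, rfl⟩
      refine ⟨h.maxDomain hd, ?_⟩
      rw [plus_lt_eq]
      exact ofRel_plus_le_eq_iff.2 ⟨rfl, radiusAntitone_of_topContinuous h.2.1⟩
    · rintro ⟨h, heq⟩
      rw [plus_lt_eq] at heq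
      obtain ⟨he', hA⟩ := ofRel_plus_le_eq_iff.1 heq
      exact ⟨smythDomain_of_maxDomain hd hA h, he'⟩
  · intro hh
    rw [← hh.smythDomain_iff]
    exact ⟨fun h => h.maxDomain hd,
      smythDomain_of_maxDomain hd (radiusAntitone_of_topContinuous hh.topContinuous)⟩
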